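/- Let $\mathbb O$ be the octonion algebra, with conjugation $z\mapsto z^*$ and norm $|z|$, where $|z|^2$ is the sum of the squares of the eight real coordinates. For vectors $a,x\in\mathbb O^n$ and $q\in\mathbb O$ write $a^*x=\sum_{i=1}^n a_i^*x_i$, $yq=(y_iq)_i$, $xx^*=(x_ix_j^*)_{i,j}$, and let $\|W\|_F=\big(\sum_{i,j}|W_{ij}|^2\big)^{1/2}$ for an octonion matrix $W$. Fix a variance $v>0$. There are constants $c,\tilde c,C>0$ (depending only on $v$) such that the following holds for all $m,n\ge 0$. Let $a_1,\dots,a_m$ be independent octonion Gaussian vectors in $\mathbb O^n$, i.e. all their $8mn$ real coordinates are independent $\mathcal N(0,v)$ variables. (i) For every $y\in\mathbb O^n$, every $q\in\mathbb O$ and $x=yq$, with probability at least $1-e^{-\frac12c^2m}$, $$\sum_{\ell=1}^m\big(|a_\ell^*x|^2-|a_\ell^*y|^2\big)^2\ \ge\ \tilde c\,m\,\|xx^*-yy^*\|_F^2 .$$ (ii) If moreover $m\ge Cn$, then with probability at least $1-e^{-\frac12c^2m}$ this inequality holds simultaneously for all $y\in\mathbb O^n$ and $q\in\mathbb O$, with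 $x=yq$. -/

import Mathlib

open MeasureTheory ProbabilityTheory Quaternion
open scoped NNReal

/-- The octonions, by the Cayley-Dickson construction from the quaternions: pairs of real
quaternions, with the Euclidean norm of the eight real coordinates. -/
def Octonion : Type := WithLp 2 (ℍ[ℝ] × ℍ[ℝ])

namespace Octonion

noncomputable instance : NormedAddCommGroup Octonion :=
  inferInstanceAs (NormedAddCommGroup (WithLp 2 (ℍ[ℝ] × ℍ[ℝ])))

/-- The octonion `p + r e₄` with quaternion components `p` and `r`. -/
def mk (p r : ℍ[ℝ]) : Octonion := WithLp.toLp 2 (p, r)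

/-- First quaternion component. -/
def fst (x : Octonion) : ℍ[ℝ] := (WithLp.ofLp x).1

/-- Second quaternion component. -/
def snd (x : Octonion) : ℍ[ℝ] := (WithLp.ofLp x).2

/-- Cayley-Dickson multiplication `(a, b)(c, d) = (a c - d̄ b, d a + b c̄)`. -/
noncomputable instance : Mul Octonion :=
  ⟨fun x y => mk (x.fst * y.fst - star y.snd * x.snd) (y.snd * x.fst + x.snd * star y.fst)⟩

/-- Octonion conjugation: the real part is kept, the seven imaginary coordinates change sign. -/
noncomputable instance : Star Octonion := ⟨fun x => mk (star x.fst) (-x.snd)⟩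

/-- The eight real coordinates of an octonion with respect to the units `1, e₁, …, e₇`. -/
noncomputable def coord (x : Octonion) : Fin 8 → ℝ :=
  ![x.fst.re, x.fst.imI, x.fst.imJ, x.fst.imK, x.snd.re, x.snd.imI, x.snd.imJ, x.snd.imK]

/-- The octonion `a* x = ∑ᵢ āᵢ xᵢ`. -/
noncomputable def conjDot {n : ℕ} (a x : Fin n → Octonion) : Octonion :=
  ∑ i, star (a i) * x i

/-- The vector `y q`: every entry of `y` is multiplied by `q` on the right. -/
noncomputable def rightScale {n : ℕ} (y : Fin n → Octonion) (q : Octonion) : Fin n → Octonion :=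
  fun i => y i * q

/-- The matrix `x x*`, with entries `xᵢ x̄ⱼ`. -/
noncomputable def outer {n : ℕ} (x : Fin n → Octonion) : Matrix (Fin n) (Fin n) Octonion :=
  Matrix.of fun i j => x i * star (x j)

/-- Frobenius norm of an octonion matrix. -/
noncomputable def frobenius {n : ℕ} (W : Matrix (Fin n) (Fin n) Octonion) : ℝ :=
  Real.sqrt (∑ i, ∑ j, ‖W i j‖ ^ 2)

/-- `a₁, …, aₘ` are independent octonion Gaussian vectors of length `n`: all their `8 m n` real
coordinates are independent centered real Gaussian variables of variance `v`. -/
def IsGaussianFamily {m n : ℕ} {Ω : Type*} [MeasurableSpace Ω] (P : Measure Ω) (v : ℝ≥0)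
    (a : Fin m → Ω → Fin n → Octonion) : Prop :=
  (∀ (l : Fin m) (i : Fin n) (k : Fin 8),
      HasLaw (fun ω => (a l ω i).coord k) (gaussianReal 0 v) P) ∧
    iIndepFun (fun (p : Fin m × Fin n × Fin 8) (ω : Ω) => (a p.1 ω p.2.1).coord p.2.2) P

end Octonion

/-! In the real coordinates of `a`, `|a* x|² - |a* y|²` is a quadratic form of rank at most 16:
eight squares of linear functionals minus eight others. Its squared Hilbert–Schmidt norm is at least
`‖x x* - y y*‖_F²`, because every coordinate of `xᵢ x̄ⱼ` is, up to sign, an entry of the form's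
matrix (`coord_mul_star`, `exists_diagonal_form`). Diagonalize and divide by that norm: the form
becomes `Q = ∑ₖ ⟪wₖ, ·⟫ ⟪uₖ, ·⟫` with vectors in the unit ball.

For a standard Gaussian `g`, the second moment of `Q(g)` is bounded below and its fourth moment is
bounded in terms of the rank only. This bounds `E|Q(g)|` below, and a Chernoff argument gives `∑
|Q(g_l)| > 2 τ m` outside an event of probability `exp(-κ m)` (`exists_small_ball_bound`).
Cauchy–Schwarz turns this into the bound on `∑ Q(g_l)²`.

For uniformity, take a net for the 32 vectors `wₖ, uₖ`. Its cardinality is exponential in the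
dimension, so `m ≥ C n` pays for the union bound. Moving from a form to a nearby one costs at most
`τ m`, by the bound `∑ ⟪u, g_l⟫² ≤ 4 t m` on the unit ball, itself obtained from a net
(`exists_uniform_small_ball_bound`). -/

/-! ### Quadratic forms given by two lists of vectors. -/

section QuadraticForms

variable {E : Type*} [NormedAddCommGroup E] [InnerProductSpace ℝ E]

open scoped RealInnerProductSpace

/-- The quadratic form `x ↦ ∑ₖ ⟪wₖ, x⟫ ⟪uₖ, x⟫`. -/
noncomputable def sumInnerMul {r : ℕ} (w u : Fin r → E) (x : E) : ℝ :=
  ∑ k, ⟪w k, x⟫ * ⟪u k, x⟫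

@[fun_prop]
theorem continuous_sumInnerMul {r : ℕ} (w u : Fin r → E) : Continuous (sumInnerMul w u) := by
  unfold sumInnerMul; fun_prop

/-- Cauchy–Schwarz twice over the `r` terms, then AM-GM on each product; only moments of single
linear functionals remain. -/
theorem sumInnerMul_pow_four_le {r : ℕ} (w u : Fin r → E) (x : E) :
    sumInnerMul w u x ^ 4 ≤ (r : ℝ) ^ 3 * ∑ k, (⟪w k, x⟫ ^ 8 + ⟪u k, x⟫ ^ 8) := by
  have h1 := sq_sum_le_card_mul_sum_sq (s := Finset.univ) (f := fun k => ⟪w k, x⟫ * ⟪u k, x⟫)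
  have h2 := sq_sum_le_card_mul_sum_sq (s := Finset.univ)
    (f := fun k => (⟪w k, x⟫ * ⟪u k, x⟫) ^ 2)
  simp only [Finset.card_univ, Fintype.card_fin] at h1 h2
  have h3 : ∑ k, ((⟪w k, x⟫ * ⟪u k, x⟫) ^ 2) ^ 2 ≤ ∑ k, (⟪w k, x⟫ ^ 8 + ⟪u k, x⟫ ^ 8) :=
    Finset.sum_le_sum fun k _ => by
      nlinarith [sq_nonneg (⟪w k, x⟫ ^ 4 - ⟪u k, x⟫ ^ 4), sq_nonneg (⟪w k, x⟫ ^ 4),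
        sq_nonneg (⟪u k, x⟫ ^ 4)]
  calc sumInnerMul w u x ^ 4 = ((∑ k, ⟪w k, x⟫ * ⟪u k, x⟫) ^ 2) ^ 2 := by
        unfold sumInnerMul; ring
    _ ≤ (r * ∑ k, (⟪w k, x⟫ * ⟪u k, x⟫) ^ 2) ^ 2 := by gcongr
    _ = (r : ℝ) ^ 2 * (∑ k, (⟪w k, x⟫ * ⟪u k, x⟫) ^ 2) ^ 2 := by ring
    _ ≤ (r : ℝ) ^ 2 * (r * ∑ k, ((⟪w k, x⟫ * ⟪u k, x⟫) ^ 2) ^ 2) := by gcongr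
    _ ≤ (r : ℝ) ^ 2 * (r * ∑ k, (⟪w k, x⟫ ^ 8 + ⟪u k, x⟫ ^ 8)) := by gcongr
    _ = _ := by ring

end QuadraticForms

/-! ### Gaussian moments of linear and quadratic forms. -/

section GaussianForms

variable {E : Type*} [NormedAddCommGroup E] [InnerProductSpace ℝ E] [FiniteDimensional ℝ E]
  [MeasurableSpace E] [BorelSpace E]

open scoped RealInnerProductSpace

theorem map_inner_stdGaussian (u : E) :
    (stdGaussian E).map (fun x => ⟪u, x⟫) = (gaussianReal 0 1).map (fun t => ‖u‖ * t) := by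
  have h := IsGaussian.map_eq_gaussianReal (μ := stdGaussian E) (innerSL ℝ u)
  rw [integral_strongDual_stdGaussian, variance_dual_stdGaussian, innerSL_apply_norm] at h
  have h2 := gaussianReal_map_const_mul (μ := 0) (v := 1) ‖u‖
  rw [mul_zero, mul_one] at h2
  have e : (fun x => ⟪u, x⟫) = ⇑(innerSL ℝ u) := rfl
  rw [e, h, h2]
  congr 1
  ext
  simp

theorem integrable_comp_inner_stdGaussian {f : ℝ → ℝ} (hf : Continuous f) (u : E)
    (h : Integrable (fun t => f (‖u‖ * t)) (gaussianReal 0 1)) :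
    Integrable (fun x => f ⟪u, x⟫) (stdGaussian E) := by
  have h1 : Integrable f ((gaussianReal 0 1).map (fun t => ‖u‖ * t)) :=
    (integrable_map_measure hf.aestronglyMeasurable (by fun_prop)).2 h
  rw [← map_inner_stdGaussian] at h1
  exact (integrable_map_measure hf.aestronglyMeasurable (by fun_prop)).1 h1

theorem integral_comp_inner_stdGaussian {f : ℝ → ℝ} (hf : Continuous f) (u : E) :
    ∫ x, f ⟪u, x⟫ ∂(stdGaussian E) = ∫ t, f (‖u‖ * t) ∂(gaussianReal 0 1) := by
  rw [← integral_map (φ := fun x : E => ⟪u, x⟫) (by fun_prop) hf.aestronglyMeasurable,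
    map_inner_stdGaussian, integral_map (by fun_prop) hf.aestronglyMeasurable]

theorem integrable_pow_gaussianReal (k : ℕ) :
    Integrable (fun t : ℝ => t ^ k) (gaussianReal 0 1) := by
  have h := (memLp_id_gaussianReal (μ := 0) (v := 1) (k : ℝ≥0)).integrable_norm_pow'
  refine (integrable_norm_iff (by fun_prop)).1 ?_
  simpa using h

/-- The `k`-th moment of the standard real Gaussian. -/
noncomputable def gaussMoment (k : ℕ) : ℝ := ∫ t, t ^ k ∂(gaussianReal 0 1)

theorem integrable_inner_pow_stdGaussian (u : E) (k : ℕ) :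
    Integrable (fun x => ⟪u, x⟫ ^ k) (stdGaussian E) := by
  refine integrable_comp_inner_stdGaussian (f := fun t => t ^ k) (by fun_prop) u ?_
  simp_rw [mul_pow]
  exact (integrable_pow_gaussianReal k).const_mul _

theorem integral_inner_pow_stdGaussian (u : E) (k : ℕ) :
    ∫ x, ⟪u, x⟫ ^ k ∂(stdGaussian E) = ‖u‖ ^ k * gaussMoment k := by
  rw [integral_comp_inner_stdGaussian (f := fun t => t ^ k) (by fun_prop) u]
  simp_rw [mul_pow]
  rw [integral_const_mul, gaussMoment]

theorem gaussMoment_four_pos : 0 < gaussMoment 4 := by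
  have h2 : ∫ t, t ^ 2 ∂(gaussianReal 0 1) = 1 := by
    have := variance_id_gaussianReal (μ := 0) (v := 1)
    rw [variance_eq_integral (by fun_prop)] at this
    simpa using this
  have : ∫ t, (2 * t ^ 2 - 1) ∂(gaussianReal 0 1) ≤ gaussMoment 4 := by
    refine integral_mono (((integrable_pow_gaussianReal 2).const_mul 2).sub (integrable_const _))
      (integrable_pow_gaussianReal 4) fun t => ?_
    nlinarith [sq_nonneg (t ^ 2 - 1)]
  rw [integral_sub ((integrable_pow_gaussianReal 2).const_mul 2) (integrable_const _),
    integral_const_mul, h2] at this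
  simp at this
  linarith

theorem gaussMoment_eight_nonneg : 0 ≤ gaussMoment 8 :=
  integral_nonneg fun t => by positivity

theorem sq_mul_sq_polarization (s t : ℝ) :
    s ^ 2 * t ^ 2 = (1 / 12) * ((s + t) ^ 4 + (s - t) ^ 4 - 2 * s ^ 4 - 2 * t ^ 4) := by ring

theorem integrable_inner_sq_mul_inner_sq (u w : E) :
    Integrable (fun x => ⟪u, x⟫ ^ 2 * ⟪w, x⟫ ^ 2) (stdGaussian E) := by
  simp_rw [sq_mul_sq_polarization, ← inner_add_left, ← inner_sub_left]
  exact ((((integrable_inner_pow_stdGaussian _ 4).add (integrable_inner_pow_stdGaussian _ 4)).sub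
    ((integrable_inner_pow_stdGaussian _ 4).const_mul 2)).sub
    ((integrable_inner_pow_stdGaussian _ 4).const_mul 2)).const_mul _

/-- Polarization reduces the mixed moment to fourth moments of single functionals, so no joint law
is needed and `gaussMoment 4` can stay symbolic. -/
theorem integral_inner_sq_mul_inner_sq (u w : E) :
    ∫ x, ⟪u, x⟫ ^ 2 * ⟪w, x⟫ ^ 2 ∂(stdGaussian E) =
      gaussMoment 4 / 3 * (‖u‖ ^ 2 * ‖w‖ ^ 2 + 2 * ⟪u, w⟫ ^ 2) := by
  have e (x : E) := sq_mul_sq_polarization ⟪u, x⟫ ⟪w, x⟫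
  simp only [e, ← inner_add_left, ← inner_sub_left]
  have i1 := integrable_inner_pow_stdGaussian (u + w) 4
  have i2 := integrable_inner_pow_stdGaussian (u - w) 4
  have i3 := (integrable_inner_pow_stdGaussian u 4).const_mul 2
  have i4 := (integrable_inner_pow_stdGaussian w 4).const_mul 2
  have i12 : Integrable (fun x => ⟪u + w, x⟫ ^ 4 + ⟪u - w, x⟫ ^ 4) (stdGaussian E) := i1.add i2
  have i123 : Integrable (fun x => ⟪u + w, x⟫ ^ 4 + ⟪u - w, x⟫ ^ 4 - 2 * ⟪u, x⟫ ^ 4)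
    (stdGaussian E) := i12.sub i3
  rw [integral_const_mul, integral_sub i123 i4, integral_sub i12 i3,
    integral_add i1 i2, integral_const_mul, integral_const_mul]
  simp only [integral_inner_pow_stdGaussian]
  have e1 := norm_add_sq_real u w
  have e2 := norm_sub_sq_real u w
  have p (z : E) : ‖z‖ ^ 4 = (‖z‖ ^ 2) ^ 2 := by ring
  rw [p (u + w), p (u - w), e1, e2]
  ring

theorem integrable_sumInnerMul_pow_four {r : ℕ} (w u : Fin r → E) :
    Integrable (fun x => sumInnerMul w u x ^ 4) (stdGaussian E) := by
  have h : Integrable (fun x => (r : ℝ) ^ 3 * ∑ k, (⟪w k, x⟫ ^ 8 + ⟪u k, x⟫ ^ 8))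
      (stdGaussian E) :=
    (integrable_finsetSum _ fun k _ => (integrable_inner_pow_stdGaussian (w k) 8).add
      (integrable_inner_pow_stdGaussian (u k) 8)).const_mul _
  refine h.mono' (by fun_prop) (.of_forall fun x => ?_)
  rw [Real.norm_of_nonneg (by positivity)]
  exact sumInnerMul_pow_four_le w u x

/-- The bound involves the rank but not the dimension of `E`; this is what makes the final constants
independent of `n`. -/
theorem integral_sumInnerMul_pow_four_le {r : ℕ} {w u : Fin r → E} (hw : ∀ k, ‖w k‖ ≤ 1)
    (hu : ∀ k, ‖u k‖ ≤ 1) :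
    ∫ x, sumInnerMul w u x ^ 4 ∂(stdGaussian E) ≤ 2 * r ^ 4 * gaussMoment 8 := by
  have i (k : Fin r) : Integrable (fun x => ⟪w k, x⟫ ^ 8 + ⟪u k, x⟫ ^ 8) (stdGaussian E) :=
    (integrable_inner_pow_stdGaussian (w k) 8).add (integrable_inner_pow_stdGaussian (u k) 8)
  calc _ ≤ ∫ x, (r : ℝ) ^ 3 * ∑ k, (⟪w k, x⟫ ^ 8 + ⟪u k, x⟫ ^ 8) ∂(stdGaussian E) :=
        integral_mono (integrable_sumInnerMul_pow_four w u)
          ((integrable_finsetSum _ fun k _ => i k).const_mul _) (sumInnerMul_pow_four_le w u)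
    _ = (r : ℝ) ^ 3 * ∑ k, (‖w k‖ ^ 8 * gaussMoment 8 + ‖u k‖ ^ 8 * gaussMoment 8) := by
        rw [integral_const_mul, integral_finsetSum _ fun k _ => i k]
        congr 1
        refine Finset.sum_congr rfl fun k _ => ?_
        rw [integral_add (integrable_inner_pow_stdGaussian _ 8)
          (integrable_inner_pow_stdGaussian _ 8)]
        simp_rw [integral_inner_pow_stdGaussian]
    _ ≤ (r : ℝ) ^ 3 * ∑ k : Fin r, (1 * gaussMoment 8 + 1 * gaussMoment 8) := by
        have := gaussMoment_eight_nonneg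
        gcongr with k
        · exact pow_le_one₀ (norm_nonneg _) (hw k)
        · exact pow_le_one₀ (norm_nonneg _) (hu k)
    _ = _ := by simp; ring

/-- The two summands are the squared trace and twice the squared Hilbert–Schmidt norm of `∑ cₖ uₖ ⊗
uₖ`; dropping the trace gives the lower bound used later. -/
theorem integral_sumInnerMul_smul_sq {r : ℕ} (c : Fin r → ℝ) (u : Fin r → E) :
    ∫ x, sumInnerMul (fun k => c k • u k) u x ^ 2 ∂(stdGaussian E) =
      gaussMoment 4 / 3 * ((∑ k, c k * ‖u k‖ ^ 2) ^ 2 +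
        2 * ∑ k, ∑ l, c k * c l * ⟪u k, u l⟫ ^ 2) := by
  have e (x : E) : sumInnerMul (fun k => c k • u k) u x ^ 2 =
      ∑ k, ∑ l, c k * c l * (⟪u k, x⟫ ^ 2 * ⟪u l, x⟫ ^ 2) := by
    rw [sumInnerMul, sq, Finset.sum_mul_sum]
    refine Finset.sum_congr rfl fun k _ => Finset.sum_congr rfl fun l _ => ?_
    simp only [real_inner_smul_left]
    ring
  simp_rw [e]
  have i (k l : Fin r) := (integrable_inner_sq_mul_inner_sq (u k) (u l)).const_mul (c k * c l)
  rw [integral_finsetSum _ fun k _ => integrable_finsetSum _ fun l _ => i k l]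
  simp_rw [integral_finsetSum _ fun l _ => i _ l, integral_const_mul,
    integral_inner_sq_mul_inner_sq]
  rw [sq (∑ k, c k * ‖u k‖ ^ 2), Finset.sum_mul_sum, Finset.mul_sum, ← Finset.sum_add_distrib,
    Finset.mul_sum]
  refine Finset.sum_congr rfl fun k _ => ?_
  rw [Finset.mul_sum, ← Finset.sum_add_distrib, Finset.mul_sum]
  refine Finset.sum_congr rfl fun l _ => ?_
  ring

end GaussianForms

/-! ### Exponential tail bounds for independent sums. -/

section Chernoff

variable {α : Type*} [MeasurableSpace α]

/-- Markov's inequality at level 1 for the product of the `exp (f (g l))`. Shift and scale are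
absorbed in `f`, so it serves lower and upper tails alike. -/
theorem pi_real_sum_nonneg_le (μ : Measure α) [IsProbabilityMeasure μ] {f : α → ℝ}
    (hf : Integrable (fun x => Real.exp (f x)) μ) (m : ℕ) :
    (Measure.pi fun _ : Fin m => μ).real {g | 0 ≤ ∑ l, f (g l)} ≤
      (∫ x, Real.exp (f x) ∂μ) ^ m := by
  have hi : Integrable (fun g : Fin m → α => ∏ l, Real.exp (f (g l)))
      (Measure.pi fun _ : Fin m => μ) := Integrable.fintype_prod fun _ => hf
  have h := mul_meas_ge_le_integral_of_nonneg
    (.of_forall fun g => Finset.prod_nonneg fun l _ => (Real.exp_pos _).le) hi 1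
  rw [integral_fintype_prod_eq_pow (fun x => Real.exp (f x)), one_mul,
    Fintype.card_fin] at h
  refine le_trans (le_of_eq ?_) h
  congr 1
  ext g
  simp only [Set.mem_ofPred_eq]
  rw [← Real.exp_sum, Real.one_le_exp_iff]

theorem linear_sub_cubic_le_one {A B t : ℝ} (hA : 0 ≤ A) (hB : A ^ 3 ≤ B) (ht : 0 ≤ t) :
    A * t - B * t ^ 3 ≤ 1 := by
  have h1 : (A * t) ^ 3 ≤ B * t ^ 3 := by rw [mul_pow]; gcongr
  have h2 : 0 ≤ A * t := by positivity
  nlinarith [sq_nonneg (A * t - 1), sq_nonneg (A * t)]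

/-- `(1 - t + t²/2)(1 + t + t²/2) = 1 + t⁴/4 ≥ 1`, and the second factor is at most `exp t`. -/
theorem exp_neg_le_quadratic {t : ℝ} (ht : 0 ≤ t) : Real.exp (-t) ≤ 1 - t + t ^ 2 / 2 := by
  have h := Real.quadratic_le_exp_of_nonneg ht
  rw [Real.exp_neg, inv_le_comm₀ (Real.exp_pos _) (by nlinarith [sq_nonneg (t - 1)])]
  refine le_trans ?_ h
  rw [inv_le_iff_one_le_mul₀ (by nlinarith [sq_nonneg (t - 1)])]
  nlinarith [sq_nonneg (t ^ 2)]

/-- A lower bound on the second and an upper bound on the fourth moment force the Laplace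
transform below `exp (-2 s τ)`, with constants that depend on the two bounds only. -/
theorem exists_integral_exp_sub_abs_le {b M : ℝ} (hb : 0 < b) (hM : 0 < M) :
    ∃ s > 0, ∃ τ > 0, ∃ κ > 0, ∀ {α : Type*} [MeasurableSpace α] (μ : Measure α)
      [IsProbabilityMeasure μ] (X : α → ℝ), AEStronglyMeasurable X μ →
      Integrable (fun x => X x ^ 4) μ → b ≤ ∫ x, X x ^ 2 ∂μ → ∫ x, X x ^ 4 ∂μ ≤ M →
      Integrable (fun x => Real.exp (s * (2 * τ - |X x|))) μ ∧
      ∫ x, Real.exp (s * (2 * τ - |X x|)) ∂μ ≤ Real.exp (-κ) := by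
  set A := min 1 (b / (2 * M)) with hA
  have hA0 : 0 < A := by positivity
  have hA1 : A ≤ 1 := min_le_left _ _
  have hA2 : A ≤ b / (2 * M) := min_le_right _ _
  set η := A * b / 2 with hη
  have hη0 : 0 < η := by positivity
  set D := 1 + M with hD
  have hD0 : 0 < D := by positivity
  -- Here `η` bounds `E|X|` below and `D` bounds `E X²` above. The choice `s = η / D` minimizes `-s
  -- η + s² D / 2`, with value `-η² / (2 D)`; the shift `2 s τ` gives back half of this.
  refine ⟨η / D, by positivity, η / 8, by positivity, η ^ 2 / (4 * D), by positivity, ?_⟩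
  intro α _ μ _ X hX h4 hXb hXM
  have h2 : Integrable (fun x => X x ^ 2) μ := by
    refine ((integrable_const (1 : ℝ)).add h4).mono' (by fun_prop) (.of_forall fun x => ?_)
    rw [Real.norm_of_nonneg (by positivity)]
    simp only [Pi.add_apply]
    nlinarith [sq_nonneg (X x ^ 2 - 1)]
  have h1 : Integrable (fun x => |X x|) μ := by
    refine ((integrable_const (1 : ℝ)).add h2).mono' (by fun_prop) (.of_forall fun x => ?_)
    rw [Real.norm_of_nonneg (by positivity)]
    simp only [Pi.add_apply]
    nlinarith [sq_nonneg (|X x| - 1), sq_abs (X x), abs_nonneg (X x)]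
  -- Integrate `|X| ≥ A X² - A (b / (2 M)) X⁴`: the fourth-moment term costs at most half of `A b`.
  have e1 : η ≤ ∫ x, |X x| ∂μ := by
    have hB : A ^ 3 ≤ A * (b / (2 * M)) := by
      have : A * A ≤ b / (2 * M) := (mul_le_of_le_one_left hA0.le hA1).trans hA2
      calc A ^ 3 = A * (A * A) := by ring
        _ ≤ _ := by gcongr
    have : ∫ x, (A * X x ^ 2 - A * (b / (2 * M)) * X x ^ 4) ∂μ ≤ ∫ x, |X x| ∂μ := by
      refine integral_mono ((h2.const_mul _).sub (h4.const_mul _)) h1 fun x => ?_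
      have := linear_sub_cubic_le_one hA0.le hB (abs_nonneg (X x))
      have e : X x ^ 4 = |X x| ^ 3 * |X x| := by
        rw [← pow_succ, Even.pow_abs (by decide)]
      have e' : X x ^ 2 = |X x| * |X x| := by rw [abs_mul_abs_self, sq]
      simp only
      rw [e, e']
      nlinarith [abs_nonneg (X x)]
    rw [integral_sub (h2.const_mul _) (h4.const_mul _), integral_const_mul,
      integral_const_mul] at this
    have t1 : A * b ≤ A * ∫ x, X x ^ 2 ∂μ := by gcongr
    have t2 : A * (b / (2 * M)) * ∫ x, X x ^ 4 ∂μ ≤ A * (b / (2 * M)) * M := by gcongr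
    have t3 : A * (b / (2 * M)) * M = A * b / 2 := by field_simp
    rw [hη]; linarith
  have e2 : ∫ x, X x ^ 2 ∂μ ≤ D := by
    have : ∫ x, X x ^ 2 ∂μ ≤ ∫ x, (1 + X x ^ 4) ∂μ :=
      integral_mono h2 ((integrable_const _).add h4) fun x => by
        simp only
        nlinarith [sq_nonneg (X x ^ 2 - 1)]
    rw [integral_add (integrable_const _) h4] at this
    simp at this
    linarith
  set s := η / D with hs
  have hs0 : 0 < s := by positivity
  have hle (x : α) : Real.exp (s * (2 * (η / 8) - |X x|)) ≤
      Real.exp (s * η / 4) * (1 - s * |X x| + s ^ 2 / 2 * X x ^ 2) := by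
    have h := exp_neg_le_quadratic (t := s * |X x|) (by positivity)
    have e : s * (2 * (η / 8) - |X x|) = s * η / 4 + -(s * |X x|) := by ring
    rw [e, Real.exp_add]
    gcongr
    refine h.trans (le_of_eq ?_)
    rw [mul_pow, sq_abs]; ring
  have hint : Integrable (fun x => Real.exp (s * η / 4) *
      (1 - s * |X x| + s ^ 2 / 2 * X x ^ 2)) μ :=
    (((integrable_const _).sub (h1.const_mul _)).add (h2.const_mul _)).const_mul _
  have hint' : Integrable (fun x => Real.exp (s * (2 * (η / 8) - |X x|))) μ := by
    refine hint.mono' (Real.continuous_exp.comp_aestronglyMeasurable (by fun_prop))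
      (.of_forall fun x => ?_)
    rw [Real.norm_of_nonneg (Real.exp_pos _).le]
    exact hle x
  refine ⟨hint', (integral_mono hint' hint hle).trans ?_⟩
  have h3 : Integrable (fun x => 1 - s * |X x|) μ := (integrable_const _).sub (h1.const_mul _)
  rw [integral_const_mul, integral_add h3
    (h2.const_mul _), integral_sub (integrable_const _) (h1.const_mul _), integral_const_mul,
    integral_const_mul]
  simp only [integral_const, probReal_univ, smul_eq_mul, mul_one]
  have e3 : 1 - s * ∫ x, |X x| ∂μ + s ^ 2 / 2 * ∫ x, X x ^ 2 ∂μ ≤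
      Real.exp (-(η ^ 2 / (2 * D))) := by
    have t1 : s * η ≤ s * ∫ x, |X x| ∂μ := by gcongr
    have t2 : s ^ 2 / 2 * ∫ x, X x ^ 2 ∂μ ≤ s ^ 2 / 2 * D := by gcongr
    have t3 := Real.add_one_le_exp (-(η ^ 2 / (2 * D)))
    have t4 : s * η = η ^ 2 / D := by rw [hs]; ring
    have t5 : s ^ 2 / 2 * D = η ^ 2 / (2 * D) := by rw [hs]; field_simp
    have t6 : η ^ 2 / D = 2 * (η ^ 2 / (2 * D)) := by field_simp
    linarith
  calc _ ≤ Real.exp (s * η / 4) * Real.exp (-(η ^ 2 / (2 * D))) := by gcongr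
    _ = Real.exp (-(η ^ 2 / (4 * D))) := by
      rw [← Real.exp_add, hs]; congr 1; field_simp; ring

end Chernoff

/-! ### Nets of the unit ball with exponential cardinality. -/

section Nets

variable (E : Type*) [NormedAddCommGroup E] [NormedSpace ℝ E] [FiniteDimensional ℝ E]

/-- A `1/2`-separated subset of the ball of maximal cardinality is a net; doubled, it is
`1`-separated in the ball of radius 2, where the Besicovitch bound `5 ^ d` applies. -/
theorem exists_finset_half_net :
    ∃ A : Finset E, A.card ≤ 5 ^ Module.finrank ℝ E ∧
      ∀ u : E, ‖u‖ ≤ 1 → ∃ a ∈ A, ‖a‖ ≤ 1 ∧ ‖u - a‖ ≤ 1 / 2 := by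
  classical
  let p (s : Finset E) : Prop :=
    (∀ c ∈ s, ‖c‖ ≤ 1) ∧ ∀ c ∈ s, ∀ d ∈ s, c ≠ d → 1 / 2 ≤ ‖c - d‖
  have hcard (s : Finset E) (hs : p s) : s.card ≤ 5 ^ Module.finrank ℝ E := by
    have hinj : Function.Injective fun x : E => (2 : ℝ) • x :=
      smul_right_injective E two_ne_zero
    rw [← Finset.card_image_of_injective s hinj]
    refine Besicovitch.card_le_of_separated _ ?_ ?_
    · simp only [Finset.mem_image, forall_exists_index, and_imp, forall_apply_eq_imp_iff₂]
      intro c hc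
      rw [norm_smul, Real.norm_two]
      linarith [hs.1 c hc]
    · simp only [Finset.mem_image, forall_exists_index, and_imp, forall_apply_eq_imp_iff₂]
      intro c hc d hd hne
      rw [← smul_sub, norm_smul, Real.norm_two]
      have := hs.2 c hc d hd fun h => hne (by rw [h])
      linarith
  let S : Set ℕ := {k | ∃ s, p s ∧ s.card = k}
  have hbdd : BddAbove S := ⟨_, by rintro _ ⟨s, hs, rfl⟩; exact hcard s hs⟩
  obtain ⟨A, hA, hAc⟩ : sSup S ∈ S := Nat.sSup_mem ⟨0, ∅, by simp [p], rfl⟩ hbdd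
  refine ⟨A, hcard A hA, fun u hu => ?_⟩
  by_contra! hcon
  have hfar (a : E) (ha : a ∈ A) : 1 / 2 < ‖u - a‖ := hcon a ha (hA.1 a ha)
  have hnot : u ∉ A := fun h => by simpa using (hfar u h).le.trans_lt' (by norm_num : (0 : ℝ) < _)
  have hp : p (insert u A) := by
    refine ⟨fun c hc => ?_, fun c hc d hd hne => ?_⟩
    · rcases Finset.mem_insert.1 hc with rfl | h
      exacts [hu, hA.1 c h]
    · rcases Finset.mem_insert.1 hc with rfl | h <;> rcases Finset.mem_insert.1 hd with rfl | h'
      · exact absurd rfl hne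
      · exact (hfar d h').le
      · rw [norm_sub_rev]; exact (hfar c h).le
      · exact hA.2 c h d h' hne
  have := le_csSup hbdd (show (insert u A).card ∈ S from ⟨_, hp, rfl⟩)
  rw [Finset.card_insert_of_notMem hnot] at this
  omega

/-- Each step approximates the rescaled remainder by the half-net. The resulting points may leave
the unit ball. -/
theorem exists_finset_net (j : ℕ) :
    ∃ A : Finset E, A.card ≤ 5 ^ (Module.finrank ℝ E * j) ∧
      ∀ u : E, ‖u‖ ≤ 1 → ∃ a ∈ A, ‖u - a‖ ≤ (1 / 2) ^ j := by
  classical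
  obtain ⟨B, hB, hBnet⟩ := exists_finset_half_net E
  induction j with
  | zero => exact ⟨{0}, by simp, fun u hu => ⟨0, by simp, by simpa using hu⟩⟩
  | succ j ih =>
    obtain ⟨A, hA, hAnet⟩ := ih
    refine ⟨Finset.image₂ (fun a b => a + (1 / 2 : ℝ) ^ j • b) A B, ?_, fun u hu => ?_⟩
    · refine (Finset.card_image₂_le _ _ _).trans ?_
      rw [mul_add, pow_add, mul_one]
      exact Nat.mul_le_mul hA hB
    · obtain ⟨a, ha, hua⟩ := hAnet u hu
      have hpos : (0 : ℝ) < (1 / 2) ^ j := by positivity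
      obtain ⟨b, hb, -, hub⟩ := hBnet (((1 / 2 : ℝ) ^ j)⁻¹ • (u - a)) (by
        rw [norm_smul, norm_inv, Real.norm_of_nonneg hpos.le]
        rwa [inv_mul_le_iff₀ hpos, mul_one])
      refine ⟨_, Finset.mem_image₂_of_mem ha hb, ?_⟩
      have e : u - (a + (1 / 2 : ℝ) ^ j • b) =
          (1 / 2 : ℝ) ^ j • (((1 / 2 : ℝ) ^ j)⁻¹ • (u - a) - b) := by
        rw [smul_sub, smul_inv_smul₀ hpos.ne']; abel
      rw [e, norm_smul, Real.norm_of_nonneg hpos.le, pow_succ]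
      gcongr

end Nets

/-! ### Stability of the sums under perturbation of the form. -/

section Deterministic

variable {E : Type*} [NormedAddCommGroup E] [InnerProductSpace ℝ E]

open scoped RealInnerProductSpace

/-- For the sampling operator `G`, the net gives `‖G‖ ≤ √T + ‖G‖ / 2`, hence `‖G‖ ≤ 2 √T`. -/
theorem sum_sq_inner_le_of_half_net {m : ℕ} {g : Fin m → E} {A : Finset E} {T : ℝ}
    (hA : ∀ u : E, ‖u‖ ≤ 1 → ∃ a ∈ A, ‖a‖ ≤ 1 ∧ ‖u - a‖ ≤ 1 / 2)
    (hT : ∀ a ∈ A, ‖a‖ ≤ 1 → ∑ l, ⟪a, g l⟫ ^ 2 ≤ T) {u : E} (hu : ‖u‖ ≤ 1) :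
    ∑ l, ⟪u, g l⟫ ^ 2 ≤ 4 * T := by
  let G : E →L[ℝ] EuclideanSpace ℝ (Fin m) :=
    (EuclideanSpace.equiv (Fin m) ℝ).symm.toContinuousLinearMap ∘L
      ContinuousLinearMap.pi fun l => innerSL ℝ (g l)
  have hG (x : E) : ‖G x‖ ^ 2 = ∑ l, ⟪x, g l⟫ ^ 2 := by
    rw [EuclideanSpace.real_norm_sq_eq]
    refine Finset.sum_congr rfl fun l _ => ?_
    rw [real_inner_comm]
    rfl
  have hT0 : 0 ≤ T := by
    obtain ⟨a, ha, ha1, -⟩ := hA 0 (by simp)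
    exact (Finset.sum_nonneg fun l _ => sq_nonneg _).trans (hT a ha ha1)
  have key (x : E) (hx : ‖x‖ ≤ 1) : ‖G x‖ ≤ √T + ‖G‖ / 2 := by
    obtain ⟨a, ha, ha1, hxa⟩ := hA x hx
    have h1 : ‖G a‖ ≤ √T := Real.le_sqrt_of_sq_le ((hG a).trans_le (hT a ha ha1))
    have h2 : ‖G (x - a)‖ ≤ ‖G‖ * (1 / 2) := (G.le_opNorm _).trans (by gcongr)
    have h3 : G x = G a + G (x - a) := by rw [← map_add]; simp
    rw [h3]
    exact (norm_add_le _ _).trans (by linarith)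
  have hop : ‖G‖ ≤ √T + ‖G‖ / 2 :=
    ContinuousLinearMap.opNorm_le_of_unit_norm (by positivity) fun x hx => key x hx.le
  have h4 : ‖G u‖ ≤ 2 * √T := (key u hu).trans (by linarith)
  rw [← hG]
  calc ‖G u‖ ^ 2 ≤ (2 * √T) ^ 2 := by gcongr
    _ = 4 * T := by rw [mul_pow, Real.sq_sqrt hT0]; norm_num

theorem sum_abs_inner_mul_le {m : ℕ} {g : Fin m → E} {T : ℝ}
    (hT : ∀ u : E, ‖u‖ ≤ 1 → ∑ l, ⟪u, g l⟫ ^ 2 ≤ T) {x y : E} {a b : ℝ}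
    (hx : ‖x‖ ≤ a) (hy : ‖y‖ ≤ b) :
    ∑ l, |⟪x, g l⟫| * |⟪y, g l⟫| ≤ a * b * T := by
  have hT0 : 0 ≤ T := by simpa using hT 0 (by simp)
  have hsq {x : E} {a : ℝ} (hx : ‖x‖ ≤ a) : ∑ l, ⟪x, g l⟫ ^ 2 ≤ a ^ 2 * T := by
    rcases eq_or_ne x 0 with rfl | hne
    · simp; positivity
    have hn : 0 < ‖x‖ := norm_pos_iff.2 hne
    have h := hT (‖x‖⁻¹ • x) (by rw [norm_smul, norm_inv, norm_norm, inv_mul_cancel₀ hn.ne'])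
    simp only [real_inner_smul_left, mul_pow, ← Finset.mul_sum] at h
    rw [inv_pow, inv_mul_le_iff₀ (by positivity)] at h
    exact h.trans (by gcongr)
  have ha : 0 ≤ a := (norm_nonneg _).trans hx
  have hb : 0 ≤ b := (norm_nonneg _).trans hy
  refine abs_le_of_sq_le_sq' ?_ (by positivity) |>.2
  refine (Finset.sum_mul_sq_le_sq_mul_sq _ _ _).trans ?_
  simp only [sq_abs]
  calc _ ≤ (a ^ 2 * T) * (b ^ 2 * T) := by
        exact mul_le_mul (hsq hx) (hsq hy) (Finset.sum_nonneg fun _ _ => sq_nonneg _)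
          (by positivity)
    _ = _ := by ring

/-- Replace one factor at a time, `w' u' - w u = (w' - w) u' + w (u' - u)`, and apply Cauchy–Schwarz
over the samples. -/
theorem sum_abs_sumInnerMul_le {m r : ℕ} {g : Fin m → E} {T δ : ℝ}
    (hT : ∀ u : E, ‖u‖ ≤ 1 → ∑ l, ⟪u, g l⟫ ^ 2 ≤ T) {w u w' u' : Fin r → E}
    (hw : ∀ k, ‖w k‖ ≤ 1) (hu' : ∀ k, ‖u' k‖ ≤ 1) (hww : ∀ k, ‖w' k - w k‖ ≤ δ)
    (huu : ∀ k, ‖u' k - u k‖ ≤ δ) :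
    ∑ l, |sumInnerMul w' u' (g l)| ≤ ∑ l, |sumInnerMul w u (g l)| + 2 * r * δ * T := by
  have h (l : Fin m) : |sumInnerMul w' u' (g l)| ≤ |sumInnerMul w u (g l)| +
      ∑ k, (|⟪w' k - w k, g l⟫| * |⟪u' k, g l⟫| + |⟪w k, g l⟫| * |⟪u' k - u k, g l⟫|) := by
    have e : sumInnerMul w' u' (g l) = sumInnerMul w u (g l) +
        ∑ k, (⟪w' k - w k, g l⟫ * ⟪u' k, g l⟫ + ⟪w k, g l⟫ * ⟪u' k - u k, g l⟫) := by
      simp only [sumInnerMul, ← Finset.sum_add_distrib]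
      refine Finset.sum_congr rfl fun k _ => ?_
      simp only [inner_sub_left]
      ring
    rw [e]
    refine (abs_add_le _ _).trans (add_le_add le_rfl ((Finset.abs_sum_le_sum_abs _ _).trans ?_))
    refine Finset.sum_le_sum fun k _ => (abs_add_le _ _).trans ?_
    rw [abs_mul, abs_mul]
  refine (Finset.sum_le_sum fun l _ => h l).trans ?_
  rw [Finset.sum_add_distrib, Finset.sum_comm]
  simp only [Finset.sum_add_distrib (f := fun l => |⟪_, g l⟫| * |⟪_, g l⟫|)]
  have hk (k : Fin r) : ∑ l, |⟪w' k - w k, g l⟫| * |⟪u' k, g l⟫| +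
      ∑ l, |⟪w k, g l⟫| * |⟪u' k - u k, g l⟫| ≤ 2 * δ * T := by
    have h1 := sum_abs_inner_mul_le hT (hww k) (hu' k)
    have h2 := sum_abs_inner_mul_le hT (hw k) (huu k)
    linarith
  have := Finset.sum_le_sum fun k (_ : k ∈ Finset.univ) => hk k
  simp only [Finset.sum_const, Finset.card_univ, Fintype.card_fin, nsmul_eq_mul] at this
  linarith

end Deterministic

/-! ### Small-ball bounds for one form and for all forms. -/

section Uniform

open scoped RealInnerProductSpace

theorem exists_integral_exp_inner_sq_le :
    ∃ σ > 0, ∃ K ≥ 1, ∀ {E : Type*} [NormedAddCommGroup E] [InnerProductSpace ℝ E]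
      [FiniteDimensional ℝ E] [MeasurableSpace E] [BorelSpace E] (u : E), ‖u‖ ≤ 1 →
      Integrable (fun x => Real.exp (σ * ⟪u, x⟫ ^ 2)) (stdGaussian E) ∧
      ∫ x, Real.exp (σ * ⟪u, x⟫ ^ 2) ∂(stdGaussian E) ≤ K := by
  obtain ⟨σ, hσ, hint⟩ := IsGaussian.exists_integrable_exp_sq (gaussianReal 0 1)
  simp only [Real.norm_eq_abs, sq_abs] at hint
  refine ⟨σ, hσ, ∫ t, Real.exp (σ * t ^ 2) ∂(gaussianReal 0 1), ?_, ?_⟩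
  · have : ∫ _, (1 : ℝ) ∂(gaussianReal 0 1) ≤ ∫ t, Real.exp (σ * t ^ 2) ∂(gaussianReal 0 1) :=
      integral_mono (integrable_const _) hint fun t => Real.one_le_exp (by positivity)
    simpa using this
  · intro E _ _ _ _ _ u hu
    have hle (t : ℝ) : Real.exp (σ * (‖u‖ * t) ^ 2) ≤ Real.exp (σ * t ^ 2) := by
      rw [mul_pow]
      refine Real.exp_le_exp.2 (mul_le_mul_of_nonneg_left ?_ hσ.le)
      exact mul_le_of_le_one_left (sq_nonneg _) (pow_le_one₀ (norm_nonneg _) hu)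
    have hint' : Integrable (fun t => Real.exp (σ * (‖u‖ * t) ^ 2)) (gaussianReal 0 1) := by
      refine hint.mono' (by fun_prop) (.of_forall fun t => ?_)
      rw [Real.norm_of_nonneg (Real.exp_pos _).le]
      exact hle t
    have hc : Continuous fun t : ℝ => Real.exp (σ * t ^ 2) := by fun_prop
    refine ⟨integrable_comp_inner_stdGaussian hc u hint', ?_⟩
    rw [integral_comp_inner_stdGaussian hc u]
    exact integral_mono hint' hint hle

/-- Parameters of a quadratic form of rank at most `r` that is bounded and not degenerate. -/
structure IsNormalizedForm {E : Type*} [NormedAddCommGroup E] [InnerProductSpace ℝ E]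
    [FiniteDimensional ℝ E] [MeasurableSpace E] [BorelSpace E] {r : ℕ} (b : ℝ)
    (w u : Fin r → E) : Prop where
  norm_left_le : ∀ k, ‖w k‖ ≤ 1
  norm_right_le : ∀ k, ‖u k‖ ≤ 1
  le_integral_sq : b ≤ ∫ x, sumInnerMul w u x ^ 2 ∂(stdGaussian E)

theorem exists_small_ball_bound (r : ℕ) {b : ℝ} (hb : 0 < b) :
    ∃ τ > 0, ∃ κ > 0, ∀ {E : Type*} [NormedAddCommGroup E] [InnerProductSpace ℝ E]
      [FiniteDimensional ℝ E] [MeasurableSpace E] [BorelSpace E] (w u : Fin r → E) (m : ℕ),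
      IsNormalizedForm b w u →
      (Measure.pi fun _ : Fin m => stdGaussian E).real
        {g | ∑ l, |sumInnerMul w u (g l)| ≤ 2 * τ * m} ≤ Real.exp (-(κ * m)) := by
  obtain ⟨s, hs, τ, hτ, κ, hκ, H⟩ := exists_integral_exp_sub_abs_le
    (M := 2 * r ^ 4 * gaussMoment 8 + 1) hb
    (by have := gaussMoment_eight_nonneg; positivity)
  refine ⟨τ, hτ, κ, hκ, fun {E} _ _ _ _ _ w u m h => ?_⟩
  obtain ⟨hi, hle⟩ := H (stdGaussian E) (sumInnerMul w u) (by fun_prop)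
    (integrable_sumInnerMul_pow_four w u) h.le_integral_sq
    ((integral_sumInnerMul_pow_four_le h.norm_left_le h.norm_right_le).trans (by linarith))
  have hset : {g : Fin m → E | ∑ l, |sumInnerMul w u (g l)| ≤ 2 * τ * m} =
      {g | 0 ≤ ∑ l, s * (2 * τ - |sumInnerMul w u (g l)|)} := by
    ext g
    simp only [Set.mem_ofPred_eq]
    rw [← Finset.mul_sum, mul_nonneg_iff_of_pos_left hs, Finset.sum_sub_distrib]
    simp [mul_comm]
  rw [hset]
  refine (pi_real_sum_nonneg_le (stdGaussian E) hi m).trans ?_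
  calc _ ≤ Real.exp (-κ) ^ m :=
        pow_le_pow_left₀ (integral_nonneg fun _ => (Real.exp_pos _).le) hle m
    _ = _ := by rw [← Real.exp_nat_mul]; congr 1; ring

theorem exists_sum_sq_inner_tail (κ : ℝ) (hκ : 0 < κ) :
    ∃ t > 0, ∀ {E : Type*} [NormedAddCommGroup E] [InnerProductSpace ℝ E]
      [FiniteDimensional ℝ E] [MeasurableSpace E] [BorelSpace E] (u : E) (m : ℕ), ‖u‖ ≤ 1 →
      (Measure.pi fun _ : Fin m => stdGaussian E).real
        {g | t * m ≤ ∑ l, ⟪u, g l⟫ ^ 2} ≤ Real.exp (-(κ * m)) := by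
  obtain ⟨σ, hσ, K, hK, H⟩ := exists_integral_exp_inner_sq_le
  have hK0 : 0 < K := by linarith
  -- With this `t`, `exp (-σ t) K = exp (-κ)`: the tail can be given any prescribed rate.
  refine ⟨(κ + Real.log K) / σ, div_pos (by linarith [Real.log_nonneg hK]) hσ, ?_⟩
  intro E _ _ _ _ _ u m hu
  obtain ⟨hi, hle⟩ := H u hu
  set t := (κ + Real.log K) / σ with ht
  have hσt : σ * t = κ + Real.log K := by rw [ht]; field_simp
  have e (x : E) : Real.exp (σ * (⟪u, x⟫ ^ 2 - t)) =
      Real.exp (-(κ + Real.log K)) * Real.exp (σ * ⟪u, x⟫ ^ 2) := by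
    rw [← Real.exp_add, ← hσt]; congr 1; ring
  have hset : {g : Fin m → E | t * m ≤ ∑ l, ⟪u, g l⟫ ^ 2} =
      {g | 0 ≤ ∑ l, σ * (⟪u, g l⟫ ^ 2 - t)} := by
    ext g
    simp only [Set.mem_ofPred_eq]
    rw [← Finset.mul_sum, mul_nonneg_iff_of_pos_left hσ, Finset.sum_sub_distrib]
    simp [mul_comm]
  rw [hset]
  have hi' : Integrable (fun x => Real.exp (σ * (⟪u, x⟫ ^ 2 - t))) (stdGaussian E) := by
    simp only [e]; exact hi.const_mul _
  refine (pi_real_sum_nonneg_le (stdGaussian E) hi' m).trans ?_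
  have hle' : ∫ x, Real.exp (σ * (⟪u, x⟫ ^ 2 - t)) ∂(stdGaussian E) ≤ Real.exp (-κ) := by
    simp only [e]
    rw [integral_const_mul]
    calc _ ≤ Real.exp (-(κ + Real.log K)) * K := by gcongr
      _ = Real.exp (-κ) := by
        rw [neg_add, Real.exp_add, Real.exp_neg (Real.log K), Real.exp_log hK0]
        field_simp
  calc _ ≤ Real.exp (-κ) ^ m :=
        pow_le_pow_left₀ (integral_nonneg fun _ => (Real.exp_pos _).le) hle' m
    _ = _ := by rw [← Real.exp_nat_mul]; congr 1; ring

/-- Restricted lower isometry for Gaussian quadratic forms of rank at most `r`: a bound for a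
single form, and one that is uniform over all forms once the number of samples is at least a
constant times the dimension. -/
theorem exists_uniform_small_ball_bound (r : ℕ) {b : ℝ} (hb : 0 < b) :
    ∃ τ > 0, ∃ κ > 0, ∃ C > (0 : ℝ), ∀ {E : Type*} [NormedAddCommGroup E] [InnerProductSpace ℝ E]
      [FiniteDimensional ℝ E] [MeasurableSpace E] [BorelSpace E] (m : ℕ),
      (∀ w u : Fin r → E, IsNormalizedForm b w u →
        (Measure.pi fun _ : Fin m => stdGaussian E).real
          {g | ∑ l, |sumInnerMul w u (g l)| < τ * m} ≤ Real.exp (-(κ * m))) ∧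
      (0 < Module.finrank ℝ E → C * Module.finrank ℝ E ≤ m →
        (Measure.pi fun _ : Fin m => stdGaussian E).real
          {g | ∃ w u : Fin r → E, IsNormalizedForm b w u ∧
            ∑ l, |sumInnerMul w u (g l)| < τ * m} ≤ Real.exp (-(κ * m))) := by
  classical
  obtain ⟨τ, hτ, κ, hκ, Hball⟩ := exists_small_ball_bound r hb
  obtain ⟨t, ht, Htail⟩ := exists_sum_sq_inner_tail κ hκ
  -- The perturbation error is `2 r δ T` with `δ = 2 · 2⁻ʲ` and `T = 4 t m`, that is `16 t r 2⁻ʲ m`;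
  -- it must not exceed `τ m`. Using `r + 1` covers `r = 0`.
  obtain ⟨j, hj⟩ : ∃ j : ℕ, (1 / 2 : ℝ) ^ j < τ / (16 * t * (r + 1)) :=
    exists_pow_lt_of_lt_one (by positivity) (by norm_num)
  have hlog : 0 < Real.log 5 := Real.log_pos (by norm_num)
  refine ⟨τ, hτ, κ / 2, by positivity, 2 * ((2 * r * j + 2) * Real.log 5) / κ, by positivity,
    fun {E} _ _ _ _ _ m => ⟨fun w u h => ?_, fun hd hm => ?_⟩⟩
  · refine (measureReal_mono ?_ (measure_ne_top _ _)).trans ((Hball w u m h).trans ?_)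
    · intro g hg
      simp only [Set.mem_ofPred_eq] at hg ⊢
      have : 0 ≤ τ * m := by positivity
      linarith
    · gcongr; linarith
  set Γ := Measure.pi fun _ : Fin m => stdGaussian E
  set d := Module.finrank ℝ E
  obtain ⟨A, hAc, hA⟩ := exists_finset_half_net E
  obtain ⟨N, hNc, hN⟩ := exists_finset_net E j
  have hS (p : (Fin r → E) × (Fin r → E)) : ∃ S : Set (Fin m → E),
      Γ.real S ≤ Real.exp (-(κ * m)) ∧ ∀ g, g ∉ S →
        (∀ v : E, ‖v‖ ≤ 1 → ∑ l, ⟪v, g l⟫ ^ 2 ≤ 4 * (t * m)) →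
        ∀ w u : Fin r → E, IsNormalizedForm b w u → (∀ k, ‖w k - p.1 k‖ ≤ (1 / 2) ^ j) →
          (∀ k, ‖u k - p.2 k‖ ≤ (1 / 2) ^ j) → τ * m ≤ ∑ l, |sumInnerMul w u (g l)| := by
    by_cases h : ∃ w u : Fin r → E, IsNormalizedForm b w u ∧
        (∀ k, ‖w k - p.1 k‖ ≤ (1 / 2) ^ j) ∧ ∀ k, ‖u k - p.2 k‖ ≤ (1 / 2) ^ j
    · obtain ⟨w₀, u₀, h₀, hw₀, hu₀⟩ := h
      refine ⟨_, Hball w₀ u₀ m h₀, fun g hg hop w u h hw hu => ?_⟩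
      simp only [Set.mem_ofPred_eq, not_le] at hg
      have tri {x y z : E} (hx : ‖x - z‖ ≤ (1 / 2) ^ j) (hy : ‖y - z‖ ≤ (1 / 2) ^ j) :
          ‖x - y‖ ≤ 2 * (1 / 2) ^ j := by
        have := norm_sub_le (x - z) (y - z)
        rw [sub_sub_sub_cancel_right] at this
        linarith
      have key := sum_abs_sumInnerMul_le hop h.norm_left_le h₀.norm_right_le
        (fun k => tri (hw₀ k) (hw k)) (fun k => tri (hu₀ k) (hu k))
      have hsmall : 2 * r * (2 * (1 / 2) ^ j) * (4 * (t * m)) ≤ τ * m := by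
        have h1 : 16 * t * (r + 1) * (1 / 2 : ℝ) ^ j ≤ τ := by
          rw [lt_div_iff₀ (by positivity)] at hj
          linarith
        have h2 : 16 * t * r * (1 / 2 : ℝ) ^ j ≤ 16 * t * (r + 1) * (1 / 2 : ℝ) ^ j := by
          gcongr; linarith
        have h3 := mul_le_mul_of_nonneg_right (h2.trans h1) (Nat.cast_nonneg (α := ℝ) m)
        linarith
      linarith
    · exact ⟨∅, by simpa using (Real.exp_pos _).le, fun g _ _ w u h' hw hu =>
        absurd ⟨w, u, h', hw, hu⟩ h⟩
  choose S hSm hS using hS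
  let I := Fintype.piFinset (fun _ : Fin r => N)
  have hsub : {g : Fin m → E | ∃ w u : Fin r → E, IsNormalizedForm b w u ∧
      ∑ l, |sumInnerMul w u (g l)| < τ * m} ⊆
      (⋃ a ∈ A.filter (fun a => ‖a‖ ≤ 1), {g | t * m ≤ ∑ l, ⟪a, g l⟫ ^ 2}) ∪
        ⋃ p ∈ I ×ˢ I, S p := by
    rintro g ⟨w, u, h, hlt⟩
    by_contra hg
    simp only [Set.mem_union, Set.mem_iUnion, not_or, not_exists] at hg
    obtain ⟨hg1, hg2⟩ := hg
    have hop (v : E) (hv : ‖v‖ ≤ 1) : ∑ l, ⟪v, g l⟫ ^ 2 ≤ 4 * (t * m) := by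
      refine sum_sq_inner_le_of_half_net hA (fun a ha ha1 => ?_) hv
      have := hg1 a (Finset.mem_filter.2 ⟨ha, ha1⟩)
      simp only [Set.mem_ofPred_eq, not_le] at this
      exact this.le
    choose w' hw'N hw' using fun k => hN (w k) (h.norm_left_le k)
    choose u' hu'N hu' using fun k => hN (u k) (h.norm_right_le k)
    have hmem : (w', u') ∈ I ×ˢ I :=
      Finset.mem_product.2 ⟨Fintype.mem_piFinset.2 hw'N, Fintype.mem_piFinset.2 hu'N⟩
    exact absurd (hS (w', u') g (hg2 _ hmem) hop w u h hw' hu') (not_le.2 hlt)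
  have hU1 : Γ.real (⋃ a ∈ A.filter (fun a => ‖a‖ ≤ 1), {g | t * m ≤ ∑ l, ⟪a, g l⟫ ^ 2}) ≤
      5 ^ d * Real.exp (-(κ * m)) := by
    refine (measureReal_biUnion_finset_le _ _).trans ?_
    refine (Finset.sum_le_card_nsmul _ _ _ fun a ha =>
      Htail a m (Finset.mem_filter.1 ha).2).trans ?_
    rw [nsmul_eq_mul]
    gcongr
    exact_mod_cast (Finset.card_filter_le _ _).trans hAc
  have hU2 : Γ.real (⋃ p ∈ I ×ˢ I, S p) ≤ 5 ^ (d * j * r * 2) * Real.exp (-(κ * m)) := by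
    refine (measureReal_biUnion_finset_le _ _).trans ?_
    refine (Finset.sum_le_card_nsmul _ _ _ fun p _ => hSm p).trans ?_
    rw [nsmul_eq_mul]
    gcongr
    have hI : I.card ≤ 5 ^ (d * j * r) := by
      rw [Fintype.card_piFinset_const, pow_mul]
      simpa using Nat.pow_le_pow_left hNc r
    rw [Finset.card_product]
    have := Nat.mul_le_mul hI hI
    rw [← pow_two (5 ^ _), ← pow_mul] at this
    exact_mod_cast this
  -- Positive dimension gives a spare factor `5 ^ d ≥ 5`, which absorbs the sum of two terms.
  have hcount : (5 : ℝ) ^ d + 5 ^ (d * j * r * 2) ≤ 5 ^ ((2 * r * j + 2) * d) := by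
    have e1 : d ≤ (2 * r * j + 1) * d := by nlinarith [Nat.zero_le (r * j * d)]
    have e2 : d * j * r * 2 ≤ (2 * r * j + 1) * d := by nlinarith
    have h1 : (5 : ℝ) ^ d ≤ 5 ^ ((2 * r * j + 1) * d) := by gcongr; norm_num
    have h2 : (5 : ℝ) ^ (d * j * r * 2) ≤ 5 ^ ((2 * r * j + 1) * d) := by gcongr; norm_num
    have h3 : (5 : ℝ) ^ ((2 * r * j + 2) * d) = 5 ^ ((2 * r * j + 1) * d) * 5 ^ d := by
      rw [← pow_add]; congr 1; ring
    have h4 : (5 : ℝ) ^ 1 ≤ 5 ^ d := pow_le_pow_right₀ (by norm_num) hd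
    have h5 : (0 : ℝ) < 5 ^ ((2 * r * j + 1) * d) := by positivity
    rw [h3]
    nlinarith
  refine (measureReal_mono hsub (measure_ne_top _ _)).trans ((measureReal_union_le _ _).trans ?_)
  calc _ ≤ 5 ^ d * Real.exp (-(κ * m)) + 5 ^ (d * j * r * 2) * Real.exp (-(κ * m)) :=
        add_le_add hU1 hU2
    _ = (5 ^ d + 5 ^ (d * j * r * 2)) * Real.exp (-(κ * m)) := by ring
    _ ≤ 5 ^ ((2 * r * j + 2) * d) * Real.exp (-(κ * m)) := by gcongr
    _ = Real.exp ((2 * r * j + 2) * d * Real.log 5 - κ * m) := by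
        rw [sub_eq_add_neg, Real.exp_add, ← Real.rpow_natCast, Real.rpow_def_of_pos (by norm_num)]
        push_cast
        congr 2; ring
    _ ≤ Real.exp (-(κ / 2 * m)) := by
        gcongr
        rw [div_mul_eq_mul_div, div_le_iff₀ hκ] at hm
        linarith

end Uniform

/-! ### Diagonalization and Hilbert–Schmidt norm. -/

section Diagonalization

variable {E : Type*} [NormedAddCommGroup E] [InnerProductSpace ℝ E]

open scoped RealInnerProductSpace

/-- Spectral theorem for `∑ σᵢ zᵢ ⊗ zᵢ` on the span of the `zᵢ`, whose dimension is at most the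
number of vectors. -/
theorem exists_orthonormal_diagonalization {ι : Type*} [Fintype ι] (σ : ι → ℝ) (z : ι → E) :
    ∃ d ≤ Fintype.card ι, ∃ (c : Fin d → ℝ) (u : Fin d → E), Orthonormal ℝ u ∧
      ∀ a b : E, ∑ i, σ i * (⟪z i, a⟫ * ⟪z i, b⟫) = ∑ k, c k * (⟪u k, a⟫ * ⟪u k, b⟫) := by
  let V := Submodule.span ℝ (Set.range z)
  have : FiniteDimensional ℝ V := FiniteDimensional.span_of_finite ℝ (Set.finite_range z)
  let zV (i : ι) : V := ⟨z i, Submodule.subset_span ⟨i, rfl⟩⟩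
  let T : V →ₗ[ℝ] V := ∑ i, σ i • ((innerₛₗ ℝ (zV i)).smulRight (zV i))
  have hTapply (p q : V) : ⟪T p, q⟫ = ∑ i, σ i * (⟪zV i, p⟫ * ⟪zV i, q⟫) := by
    simp only [T, LinearMap.sum_apply, LinearMap.smul_apply, LinearMap.smulRight_apply, sum_inner,
      real_inner_smul_left, innerₛₗ_apply_apply]
  have hT : T.IsSymmetric := fun p q => by
    rw [hTapply, real_inner_comm, hTapply]
    exact Finset.sum_congr rfl fun i _ => by ring
  let B := hT.eigenvectorBasis rfl
  refine ⟨Module.finrank ℝ V, finrank_range_le_card z, hT.eigenvalues rfl, fun k => (B k : E),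
    B.orthonormal.comp_linearIsometry V.subtypeₗᵢ, fun a b => ?_⟩
  have hproj (p : V) (x : E) : ⟪p, V.orthogonalProjectionOnto x⟫ = ⟪(p : E), x⟫ := by
    exact V.inner_orthogonalProjectionOnto_eq_of_mem_left p x
  have h1 := hTapply (V.orthogonalProjectionOnto a) (V.orthogonalProjectionOnto b)
  rw [← B.sum_inner_mul_inner] at h1
  have h2 : ∑ i, σ i * (⟪zV i, V.orthogonalProjectionOnto a⟫ *
      ⟪zV i, V.orthogonalProjectionOnto b⟫) = ∑ i, σ i * (⟪z i, a⟫ * ⟪z i, b⟫) := by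
    simp only [hproj, zV]
  rw [← h2, ← h1]
  refine Finset.sum_congr rfl fun k _ => ?_
  rw [hT, hT.apply_eigenvectorBasis]
  simp only [real_inner_smul_right, hproj]
  rw [RCLike.ofReal_real_eq_id, id, real_inner_comm, hproj]
  ring

/-- Padding by zeros makes the length `r` the same for all forms. Orthonormality is lost, but its
two consequences used later survive. -/
theorem exists_diagonalization {ι : Type*} [Fintype ι] {r : ℕ} (hr : Fintype.card ι ≤ r)
    (σ : ι → ℝ) (z : ι → E) :
    ∃ (c : Fin r → ℝ) (u : Fin r → E), (∀ k, ‖u k‖ ≤ 1) ∧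
      (∑ k, ∑ l, c k * c l * ⟪u k, u l⟫ ^ 2 = ∑ k, c k ^ 2) ∧
      ∀ a b : E, ∑ i, σ i * (⟪z i, a⟫ * ⟪z i, b⟫) = ∑ k, c k * (⟪u k, a⟫ * ⟪u k, b⟫) := by
  obtain ⟨d, hd, c, u, hu, h⟩ := exists_orthonormal_diagonalization σ z
  have he := Fin.castLE_injective (hd.trans hr)
  set e := Fin.castLE (hd.trans hr)
  have sum_eq (F : Fin d → ℝ) (G : Fin r → ℝ) (hFG : ∀ k, F k = G (e k))
      (hG : ∀ k, k ∉ Set.range e → G k = 0) : ∑ k, G k = ∑ k, F k :=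
    (Fintype.sum_of_injective e he F G hG hFG).symm
  have hc0 (k : Fin r) (hk : k ∉ Set.range e) : Function.extend e c 0 k = 0 := by
    rw [Function.extend_apply' _ _ _ fun ⟨i, hi⟩ => hk ⟨i, hi⟩]; rfl
  refine ⟨Function.extend e c 0, Function.extend e u 0, fun k => ?_, ?_, fun a b => ?_⟩
  · by_cases hk : k ∈ Set.range e
    · obtain ⟨i, rfl⟩ := hk
      rw [he.extend_apply, hu.1 i]
    · rw [Function.extend_apply' _ _ _ fun ⟨i, hi⟩ => hk ⟨i, hi⟩]
      simp
  · have hsq : ∑ k, Function.extend e c 0 k ^ 2 = ∑ k, c k ^ 2 :=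
      sum_eq _ _ (fun k => by rw [he.extend_apply]) (fun k hk => by rw [hc0 k hk]; simp)
    rw [hsq]
    refine sum_eq _ _ (fun k => ?_) (fun k hk => ?_)
    · simp only [he.extend_apply]
      rw [sum_eq (fun l => c k * c l * ⟪u k, u l⟫ ^ 2)]
      · rw [Finset.sum_eq_single k]
        · rw [real_inner_self_eq_norm_sq, hu.1 k]; ring
        · intro l _ hl
          rw [hu.2 hl.symm]; ring
        · simp
      · intro l
        simp only [he.extend_apply]
      · intro l hl
        rw [hc0 l hl]; ring
    · simp [hc0 k hk]
  · rw [h]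
    symm
    refine sum_eq _ _ (fun k => ?_) (fun k hk => ?_)
    · simp only [he.extend_apply]
    · rw [hc0 k hk, zero_mul]

/-- Both sides are the squared Hilbert–Schmidt norm of `∑ cₖ uₖ ⊗ uₖ`; Parseval is applied in `p`
and in `q`. -/
theorem sum_sq_bilin_orthonormalBasis {κ : Type*} [Fintype κ] (B : OrthonormalBasis κ ℝ E) {r : ℕ}
    (c : Fin r → ℝ) (u : Fin r → E) :
    ∑ p, ∑ q, (∑ k, c k * (⟪u k, B p⟫ * ⟪u k, B q⟫)) ^ 2 =
      ∑ k, ∑ l, c k * c l * ⟪u k, u l⟫ ^ 2 := by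
  have hP (x y : E) : ∑ p, ⟪x, B p⟫ * ⟪y, B p⟫ = ⟪x, y⟫ := by
    rw [← B.sum_inner_mul_inner]
    exact Finset.sum_congr rfl fun p _ => by rw [real_inner_comm y]
  have e (p q : κ) : (∑ k, c k * (⟪u k, B p⟫ * ⟪u k, B q⟫)) ^ 2 =
      ∑ k, ∑ l, c k * c l * ((⟪u k, B p⟫ * ⟪u l, B p⟫) * (⟪u k, B q⟫ * ⟪u l, B q⟫)) := by
    rw [sq, Finset.sum_mul_sum]
    exact Finset.sum_congr rfl fun k _ => Finset.sum_congr rfl fun l _ => by ring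
  simp only [e]
  rw [Finset.sum_congr rfl fun p _ => Finset.sum_comm, Finset.sum_comm]
  refine Finset.sum_congr rfl fun k _ => ?_
  rw [Finset.sum_congr rfl fun p _ => Finset.sum_comm, Finset.sum_comm]
  refine Finset.sum_congr rfl fun l _ => ?_
  simp only [← Finset.mul_sum, hP]
  rw [← Finset.sum_mul, hP]
  ring

end Diagonalization

/-! ### Normalization of a diagonal form. -/

section Normalization

variable {E : Type*} [NormedAddCommGroup E] [InnerProductSpace ℝ E] [FiniteDimensional ℝ E]
  [MeasurableSpace E] [BorelSpace E]

open scoped RealInnerProductSpace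

theorem exists_isNormalizedForm {r : ℕ} {c : Fin r → ℝ} {u : Fin r → E} (hu : ∀ k, ‖u k‖ ≤ 1)
    (hc : ∑ k, ∑ l, c k * c l * ⟪u k, u l⟫ ^ 2 = ∑ k, c k ^ 2) (hpos : 0 < ∑ k, c k ^ 2) :
    ∃ w : Fin r → E, IsNormalizedForm (2 * gaussMoment 4 / 3) w u ∧
      ∀ (m : ℕ) (g : Fin m → E) (τ : ℝ), 0 ≤ τ → τ * m ≤ ∑ l, |sumInnerMul w u (g l)| →
        τ ^ 2 * m * ∑ k, c k ^ 2 ≤ ∑ l, (∑ k, c k * (⟪u k, g l⟫ * ⟪u k, g l⟫)) ^ 2 := by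
  set S := ∑ k, c k ^ 2 with hS
  have hs : 0 < √S := Real.sqrt_pos.2 hpos
  have hs2 : √S ^ 2 = S := Real.sq_sqrt hpos.le
  have hκ := gaussMoment_four_pos
  refine ⟨fun k => (c k / √S) • u k, ⟨fun k => ?_, hu, ?_⟩, fun m g τ hτ h => ?_⟩
  · have hck : |c k| ≤ √S := Real.abs_le_sqrt
      (Finset.single_le_sum (f := fun k => c k ^ 2) (fun _ _ => sq_nonneg _) (Finset.mem_univ k))
    rw [norm_smul, Real.norm_eq_abs, abs_div, abs_of_pos hs]
    exact mul_le_one₀ ((div_le_one hs).2 hck) (norm_nonneg _) (hu k)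
  · rw [integral_sumInnerMul_smul_sq]
    have e : ∑ k, ∑ l, c k / √S * (c l / √S) * ⟪u k, u l⟫ ^ 2 = 1 := by
      have : ∀ k l, c k / √S * (c l / √S) * ⟪u k, u l⟫ ^ 2 =
          S⁻¹ * (c k * c l * ⟪u k, u l⟫ ^ 2) := fun k l => by
        rw [div_mul_div_comm, ← sq, hs2]; ring
      simp only [this, ← Finset.mul_sum]
      rw [hc, inv_mul_cancel₀ hpos.ne']
    rw [e]
    nlinarith [mul_nonneg hκ.le (sq_nonneg (∑ k, c k / √S * ‖u k‖ ^ 2))]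
  · have e (x : E) : sumInnerMul (fun k => (c k / √S) • u k) u x =
        (∑ k, c k * (⟪u k, x⟫ * ⟪u k, x⟫)) / √S := by
      rw [sumInnerMul, Finset.sum_div]
      refine Finset.sum_congr rfl fun k _ => ?_
      rw [real_inner_smul_left]; ring
    simp only [e, abs_div, abs_of_pos hs] at h
    rw [← Finset.sum_div, le_div_iff₀ hs] at h
    rcases Nat.eq_zero_or_pos m with rfl | hm
    · simp
    have hm' : (0 : ℝ) < m := by exact_mod_cast hm
    -- Cauchy–Schwarz over the samples passes from `∑ |Q|` to `∑ Q²`.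
    have h2 := sq_sum_le_card_mul_sum_sq (s := Finset.univ)
      (f := fun l => |∑ k, c k * (⟪u k, g l⟫ * ⟪u k, g l⟫)|)
    simp only [sq_abs, Finset.card_univ, Fintype.card_fin] at h2
    have h3 := (pow_le_pow_left₀ (by positivity) h 2).trans h2
    have h4 : (τ * m * √S) ^ 2 = m * (τ ^ 2 * m * S) := by rw [mul_pow, hs2]; ring
    rw [h4] at h3
    exact le_of_mul_le_mul_left h3 hm'

end Normalization

/-! ### Octonion arithmetic in real coordinates. -/

namespace Octonion

theorem norm_sq_eq_sum_coord (x : Octonion) : ‖x‖ ^ 2 = ∑ k, x.coord k ^ 2 := by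
  have h : ‖x‖ ^ 2 = ‖x.fst‖ ^ 2 + ‖x.snd‖ ^ 2 := WithLp.prod_norm_sq_eq_of_L2 _
  have hq (q : ℍ[ℝ]) : ‖q‖ ^ 2 = q.re ^ 2 + q.imI ^ 2 + q.imJ ^ 2 + q.imK ^ 2 := by
    rw [sq, ← Quaternion.normSq_eq_norm_mul_self, Quaternion.normSq_def']
  rw [h, hq, hq]
  simp [coord, Fin.sum_univ_eight]
  ring

/-- The quaternion with the given coordinates. -/
def quat (a b c d : ℝ) : ℍ[ℝ] := ⟨a, b, c, d⟩

theorem re_quat (a b c d : ℝ) : (quat a b c d).re = a := rfl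
theorem imI_quat (a b c d : ℝ) : (quat a b c d).imI = b := rfl
theorem imJ_quat (a b c d : ℝ) : (quat a b c d).imJ = c := rfl
theorem imK_quat (a b c d : ℝ) : (quat a b c d).imK = d := rfl

/-- The `c`-th octonion unit. -/
noncomputable def unit : Fin 8 → Octonion :=
  ![mk (quat 1 0 0 0) 0, mk (quat 0 1 0 0) 0, mk (quat 0 0 1 0) 0, mk (quat 0 0 0 1) 0,
    mk 0 (quat 1 0 0 0), mk 0 (quat 0 1 0 0), mk 0 (quat 0 0 1 0), mk 0 (quat 0 0 0 1)]

theorem fst_mul (x y : Octonion) : (x * y).fst = x.fst * y.fst - star y.snd * x.snd := rfl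
theorem snd_mul (x y : Octonion) : (x * y).snd = y.snd * x.fst + x.snd * star y.fst := rfl
theorem fst_star (x : Octonion) : (star x).fst = star x.fst := rfl
theorem snd_star (x : Octonion) : (star x).snd = -x.snd := rfl
theorem fst_mk (p q : ℍ[ℝ]) : (mk p q).fst = p := rfl
theorem snd_mk (p q : ℍ[ℝ]) : (mk p q).snd = q := rfl

theorem coord_add (x y : Octonion) (k : Fin 8) : (x + y).coord k = x.coord k + y.coord k := by
  have h1 : (x + y).fst = x.fst + y.fst := rfl
  have h2 : (x + y).snd = x.snd + y.snd := rfl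
  fin_cases k <;> simp [coord, h1, h2]

theorem coord_sub (x y : Octonion) (k : Fin 8) : (x - y).coord k = x.coord k - y.coord k := by
  rw [eq_sub_iff_add_eq, ← coord_add, sub_add_cancel]

theorem coord_sum {ι : Type*} (s : Finset ι) (f : ι → Octonion) (k : Fin 8) :
    (∑ i ∈ s, f i).coord k = ∑ i ∈ s, (f i).coord k :=
  map_sum (AddMonoidHom.mk' (fun x : Octonion => x.coord k) fun x y => coord_add x y k) f s

theorem coord_mul (x y : Octonion) : (x * y).coord =
    ![x.coord 0 * y.coord 0 - x.coord 1 * y.coord 1 - x.coord 2 * y.coord 2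
        - x.coord 3 * y.coord 3 - x.coord 4 * y.coord 4 - x.coord 5 * y.coord 5
        - x.coord 6 * y.coord 6 - x.coord 7 * y.coord 7,
      x.coord 0 * y.coord 1 + x.coord 1 * y.coord 0 + x.coord 2 * y.coord 3
        - x.coord 3 * y.coord 2 + x.coord 4 * y.coord 5 - x.coord 5 * y.coord 4
        - x.coord 6 * y.coord 7 + x.coord 7 * y.coord 6,
      x.coord 0 * y.coord 2 - x.coord 1 * y.coord 3 + x.coord 2 * y.coord 0
        + x.coord 3 * y.coord 1 + x.coord 4 * y.coord 6 + x.coord 5 * y.coord 7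
        - x.coord 6 * y.coord 4 - x.coord 7 * y.coord 5,
      x.coord 0 * y.coord 3 + x.coord 1 * y.coord 2 - x.coord 2 * y.coord 1
        + x.coord 3 * y.coord 0 + x.coord 4 * y.coord 7 - x.coord 5 * y.coord 6
        + x.coord 6 * y.coord 5 - x.coord 7 * y.coord 4,
      x.coord 0 * y.coord 4 - x.coord 1 * y.coord 5 - x.coord 2 * y.coord 6
        - x.coord 3 * y.coord 7 + x.coord 4 * y.coord 0 + x.coord 5 * y.coord 1
        + x.coord 6 * y.coord 2 + x.coord 7 * y.coord 3,
      x.coord 0 * y.coord 5 + x.coord 1 * y.coord 4 - x.coord 2 * y.coord 7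
        + x.coord 3 * y.coord 6 - x.coord 4 * y.coord 1 + x.coord 5 * y.coord 0
        - x.coord 6 * y.coord 3 + x.coord 7 * y.coord 2,
      x.coord 0 * y.coord 6 + x.coord 1 * y.coord 7 + x.coord 2 * y.coord 4
        - x.coord 3 * y.coord 5 - x.coord 4 * y.coord 2 + x.coord 5 * y.coord 3
        + x.coord 6 * y.coord 0 - x.coord 7 * y.coord 1,
      x.coord 0 * y.coord 7 - x.coord 1 * y.coord 6 + x.coord 2 * y.coord 5
        + x.coord 3 * y.coord 4 - x.coord 4 * y.coord 3 - x.coord 5 * y.coord 2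
        + x.coord 6 * y.coord 1 + x.coord 7 * y.coord 0] := by
  funext k
  fin_cases k <;> simp [coord, fst_mul, snd_mul] <;> ring

theorem coord_star (x : Octonion) : (star x).coord =
    ![x.coord 0, -x.coord 1, -x.coord 2, -x.coord 3, -x.coord 4, -x.coord 5, -x.coord 6,
      -x.coord 7] := by
  funext k
  fin_cases k <;> simp [coord, fst_star, snd_star]

theorem coord_unit (c k : Fin 8) : (unit c).coord k = if k = c then 1 else 0 := by
  fin_cases c <;> fin_cases k <;>
    simp [coord, unit, fst_mk, snd_mk, re_quat, imI_quat, imJ_quat, imK_quat]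

theorem coord_star_mul (a x : Octonion) (k : Fin 8) :
    (star a * x).coord k = ∑ c, (star (unit c) * x).coord k * a.coord c := by
  fin_cases k <;> simp [Fin.sum_univ_eight, coord_mul, coord_star, coord_unit] <;> ring

/-- This is `⟪p q̄, e_c⟫ = ⟪p, e_c q⟫`; the sign comes from conjugating the unit. It identifies
coordinates of `xᵢ x̄ⱼ` with matrix entries of `a ↦ |a* x|²`. -/
theorem coord_mul_star (p q : Octonion) (c : Fin 8) :
    (p * star q).coord c = (if c = 0 then 1 else -1) *
      ∑ k, (star (unit 0) * p).coord k * (star (unit c) * q).coord k := by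
  fin_cases c <;> simp [Fin.sum_univ_eight, coord_mul, coord_star, coord_unit] <;> ring

theorem coord_mul_star_sub_sq (p q p' q' : Octonion) (c : Fin 8) :
    (p * star q - p' * star q').coord c ^ 2 =
      (∑ k, (star (unit 0) * p).coord k * (star (unit c) * q).coord k -
        ∑ k, (star (unit 0) * p').coord k * (star (unit c) * q').coord k) ^ 2 := by
  rw [coord_sub, coord_mul_star, coord_mul_star, ← mul_sub, mul_pow]
  split_ifs <;> simp

end Octonion

/-! ### From octonion samples to Gaussian quadratic forms. -/

namespace Octonion

open scoped RealInnerProductSpace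

/-- The real coordinate vector of an octonion vector. -/
noncomputable def toReal {n : ℕ} (a : Fin n → Octonion) : EuclideanSpace ℝ (Fin n × Fin 8) :=
  WithLp.toLp 2 fun p => (a p.1).coord p.2

/-- The vector representing the linear functional `a ↦ (a* x)ₖ`. -/
noncomputable def coordFunctional {n : ℕ} (x : Fin n → Octonion) (k : Fin 8) :
    EuclideanSpace ℝ (Fin n × Fin 8) :=
  WithLp.toLp 2 fun p => (star (unit p.2) * x p.1).coord k

theorem inner_coordFunctional_toReal {n : ℕ} (a x : Fin n → Octonion) (k : Fin 8) :
    ⟪coordFunctional x k, toReal a⟫ = (conjDot a x).coord k := by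
  rw [conjDot, coord_sum, PiLp.inner_apply, Fintype.sum_prod_type]
  refine Finset.sum_congr rfl fun i _ => ?_
  rw [coord_star_mul]
  refine Finset.sum_congr rfl fun c _ => ?_
  simp [coordFunctional, toReal, mul_comm]

theorem inner_coordFunctional_basisFun {n : ℕ} (x : Fin n → Octonion) (k : Fin 8)
    (p : Fin n × Fin 8) :
    ⟪coordFunctional x k, EuclideanSpace.basisFun (Fin n × Fin 8) ℝ p⟫ =
      (star (unit p.2) * x p.1).coord k := by
  rw [EuclideanSpace.basisFun_apply, EuclideanSpace.inner_single_right]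
  simp [coordFunctional]

theorem sum_unitSigns_inner {n : ℕ} (x y : Fin n → Octonion)
    (a b : EuclideanSpace ℝ (Fin n × Fin 8)) :
    ∑ i : Fin 8 ⊕ Fin 8, Sum.elim (fun _ => (1 : ℝ)) (fun _ => -1) i *
      (⟪Sum.elim (coordFunctional x) (coordFunctional y) i, a⟫ *
        ⟪Sum.elim (coordFunctional x) (coordFunctional y) i, b⟫) =
      ∑ k, ⟪coordFunctional x k, a⟫ * ⟪coordFunctional x k, b⟫ -
        ∑ k, ⟪coordFunctional y k, a⟫ * ⟪coordFunctional y k, b⟫ := by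
  simp [Fintype.sum_sum_type, sub_eq_add_neg]

theorem exists_diagonal_form {n : ℕ} (x y : Fin n → Octonion) :
    ∃ (c : Fin 16 → ℝ) (u : Fin 16 → EuclideanSpace ℝ (Fin n × Fin 8)), (∀ k, ‖u k‖ ≤ 1) ∧
      (∑ k, ∑ l, c k * c l * ⟪u k, u l⟫ ^ 2 = ∑ k, c k ^ 2) ∧
      frobenius (outer x - outer y) ^ 2 ≤ ∑ k, c k ^ 2 ∧
      ∀ a : Fin n → Octonion, ‖conjDot a x‖ ^ 2 - ‖conjDot a y‖ ^ 2 =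
        ∑ k, c k * (⟪u k, toReal a⟫ * ⟪u k, toReal a⟫) := by
  obtain ⟨c, u, hu, hc, h⟩ := exists_diagonalization (r := 16) (by simp)
    (Sum.elim (fun _ : Fin 8 => (1 : ℝ)) fun _ : Fin 8 => -1)
    (Sum.elim (coordFunctional x) (coordFunctional y))
  refine ⟨c, u, hu, hc, ?_, fun a => ?_⟩
  · rw [frobenius, Real.sq_sqrt (by positivity), ← hc,
      ← sum_sq_bilin_orthonormalBasis (EuclideanSpace.basisFun (Fin n × Fin 8) ℝ)]
    have hentry (i j : Fin n) : ‖(outer x - outer y) i j‖ ^ 2 =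
        ∑ d, (∑ k, c k * (⟪u k, EuclideanSpace.basisFun (Fin n × Fin 8) ℝ (i, 0)⟫ *
          ⟪u k, EuclideanSpace.basisFun (Fin n × Fin 8) ℝ (j, d)⟫)) ^ 2 := by
      rw [norm_sq_eq_sum_coord]
      refine Finset.sum_congr rfl fun d _ => ?_
      rw [← h, sum_unitSigns_inner]
      simp only [inner_coordFunctional_basisFun]
      exact coord_mul_star_sub_sq _ _ _ _ d
    rw [Fintype.sum_prod_type]
    refine Finset.sum_le_sum fun i _ => ?_
    -- Of the eight matrix rows belonging to `i`, the one of the real unit already contains all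
    -- coordinates of the entries `(i, j)`.
    refine le_trans (le_of_eq ?_) (Finset.single_le_sum (f := fun e => ∑ q, (∑ k, c k *
      (⟪u k, EuclideanSpace.basisFun (Fin n × Fin 8) ℝ (i, e)⟫ *
        ⟪u k, EuclideanSpace.basisFun (Fin n × Fin 8) ℝ q⟫)) ^ 2)
      (fun _ _ => Finset.sum_nonneg fun _ _ => sq_nonneg _) (Finset.mem_univ (0 : Fin 8)))
    rw [Fintype.sum_prod_type]
    exact Finset.sum_congr rfl fun j _ => hentry i j
  · rw [← h, sum_unitSigns_inner, norm_sq_eq_sum_coord, norm_sq_eq_sum_coord]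
    simp only [inner_coordFunctional_toReal, sq]

theorem exists_isNormalizedForm_of_ne_zero {n : ℕ} {x y : Fin n → Octonion}
    (hxy : 0 < frobenius (outer x - outer y) ^ 2) {v : ℝ} (hv : 0 ≤ v) :
    ∃ w u : Fin 16 → EuclideanSpace ℝ (Fin n × Fin 8),
      IsNormalizedForm (2 * gaussMoment 4 / 3) w u ∧
      ∀ (m : ℕ) (a : Fin m → Fin n → Octonion)
        (g : Fin m → EuclideanSpace ℝ (Fin n × Fin 8)) (τ : ℝ), 0 ≤ τ →
        (∀ l, toReal (a l) = √v • g l) → τ * m ≤ ∑ l, |sumInnerMul w u (g l)| →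
        v ^ 2 * τ ^ 2 * m * frobenius (outer x - outer y) ^ 2 ≤
          ∑ l, (‖conjDot (a l) x‖ ^ 2 - ‖conjDot (a l) y‖ ^ 2) ^ 2 := by
  obtain ⟨c, u, hu, hc, hF, h⟩ := exists_diagonal_form x y
  obtain ⟨w, hw, H⟩ := exists_isNormalizedForm hu hc (hxy.trans_le hF)
  refine ⟨w, u, hw, fun m a g τ hτ hag hle => ?_⟩
  have e (l : Fin m) : (‖conjDot (a l) x‖ ^ 2 - ‖conjDot (a l) y‖ ^ 2) ^ 2 =
      v ^ 2 * (∑ k, c k * (⟪u k, g l⟫ * ⟪u k, g l⟫)) ^ 2 := by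
    rw [h, hag, ← mul_pow, Finset.mul_sum]
    congr 1
    refine Finset.sum_congr rfl fun k _ => ?_
    rw [real_inner_smul_right]
    have := Real.mul_self_sqrt hv
    linear_combination (c k * ⟪u k, g l⟫ * ⟪u k, g l⟫) * this
  simp only [e, ← Finset.mul_sum]
  calc _ ≤ v ^ 2 * τ ^ 2 * m * ∑ k, c k ^ 2 := by gcongr
    _ = v ^ 2 * (τ ^ 2 * m * ∑ k, c k ^ 2) := by ring
    _ ≤ _ := by gcongr; exact H m g τ hτ hle

/-- The normalized samples of a Gaussian family are independent standard Gaussian vectors. -/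
theorem IsGaussianFamily.hasLaw {m n : ℕ} {Ω : Type*} [MeasurableSpace Ω] {P : Measure Ω}
    [IsProbabilityMeasure P] {v : ℝ≥0} (hv : 0 < v) {a : Fin m → Ω → Fin n → Octonion}
    (h : IsGaussianFamily P v a) :
    HasLaw (fun ω l => (√(v : ℝ))⁻¹ • toReal (a l ω))
      (Measure.pi fun _ : Fin m => stdGaussian (EuclideanSpace ℝ (Fin n × Fin 8))) P := by
  obtain ⟨hlaw, hind⟩ := h
  have hv' : (v : ℝ) ≠ 0 := by exact_mod_cast hv.ne'
  let Y (p : Fin m × Fin n × Fin 8) (ω : Ω) : ℝ := (a p.1 ω p.2.1).coord p.2.2 * (√(v : ℝ))⁻¹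
  have hY (p) : HasLaw (Y p) (gaussianReal 0 1) P := by
    have := gaussianReal_mul_const (hlaw p.1 p.2.1 p.2.2) (√(v : ℝ))⁻¹
    convert this using 2
    · simp
    · ext
      simp [hv']
  have hYind : iIndepFun Y P := hind.comp (fun _ t => t * (√(v : ℝ))⁻¹) fun _ => by fun_prop
  have hYm : ∀ p, AEMeasurable (Y p) P := fun p => (hY p).aemeasurable
  have hmap : P.map (fun ω p => Y p ω) =
      Measure.pi fun _ : Fin m × Fin n × Fin 8 => gaussianReal 0 1 := by
    rw [(iIndepFun_iff_map_fun_eq_pi_map hYm).1 hYind]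
    simp only [(hY _).map_eq]
  have hYall : AEMeasurable (fun ω p => Y p ω) P := aemeasurable_pi_lambda _ hYm
  have hcurry : (Measure.pi fun _ : Fin m × Fin n × Fin 8 => gaussianReal 0 1).map
      (MeasurableEquiv.curry (Fin m) (Fin n × Fin 8) ℝ) =
      Measure.pi fun _ : Fin m => Measure.pi fun _ : Fin n × Fin 8 => gaussianReal 0 1 := by
    have := Measure.infinitePi_map_curry
      (fun (_ : Fin m) (_ : Fin n × Fin 8) => gaussianReal 0 1)
    simpa only [Measure.infinitePi_eq_pi] using this
  let Φ : (Fin m × Fin n × Fin 8 → ℝ) → Fin m → EuclideanSpace ℝ (Fin n × Fin 8) :=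
    (fun z l => WithLp.toLp 2 (z l)) ∘ MeasurableEquiv.curry (Fin m) (Fin n × Fin 8) ℝ
  have h1 : Measurable fun (z : Fin m → Fin n × Fin 8 → ℝ) (l : Fin m) =>
      (WithLp.toLp 2 (z l) : EuclideanSpace ℝ (Fin n × Fin 8)) :=
    measurable_pi_lambda _ fun l =>
      (EuclideanSpace.equiv (Fin n × Fin 8) ℝ).symm.continuous.measurable.comp
        (measurable_pi_apply l)
  have hΦ : Measurable Φ := h1.comp (MeasurableEquiv.measurable _)
  have heq : (fun ω l => (√(v : ℝ))⁻¹ • toReal (a l ω)) = Φ ∘ fun ω p => Y p ω := by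
    funext ω l
    ext p
    simp [Φ, Y, toReal, mul_comm, MeasurableEquiv.curry, Function.curry]
  rw [heq]
  refine ⟨hΦ.comp_aemeasurable hYall, ?_⟩
  rw [← AEMeasurable.map_map_of_aemeasurable hΦ.aemeasurable hYall, hmap,
    ← Measure.map_map h1 (MeasurableEquiv.measurable _), hcurry,
    Measure.pi_map_pi fun _ => by fun_prop]
  simp only [map_pi_eq_stdGaussian]

/-- Only subadditivity and `Measure.le_map_apply` enter, so neither set has to be measurable; the
uniform events are defined by uncountably many conditions. -/
theorem one_sub_le_measureReal_of_compl {Ω α : Type*} [MeasurableSpace Ω] [MeasurableSpace α]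
    {P : Measure Ω} [IsProbabilityMeasure P] {μ : Measure α} {X : Ω → α} (hX : HasLaw X μ P)
    {A : Set Ω} {B : Set α} {ε : ℝ} (hB : μ.real B ≤ ε) (h : ∀ ω, X ω ∉ B → ω ∈ A) :
    1 - ε ≤ P.real A := by
  have : IsProbabilityMeasure μ := hX.map_eq ▸ Measure.isProbabilityMeasure_map hX.aemeasurable
  have h1 : P.real (X ⁻¹' B) ≤ μ.real B := by
    rw [← hX.map_eq]
    refine ENNReal.toReal_mono ?_ (Measure.le_map_apply hX.aemeasurable B)
    rw [hX.map_eq]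
    exact measure_ne_top _ _
  have h2 : P.real Set.univ ≤ P.real A + P.real (X ⁻¹' B) := by
    refine (measureReal_mono (fun ω _ => ?_) (measure_ne_top _ _)).trans (measureReal_union_le _ _)
    by_cases hω : X ω ∈ B
    · exact .inr hω
    · exact .inl (h ω hω)
  rw [probReal_univ] at h2
  linarith

end Octonion

/-! ### Assembly of the two bounds. -/

theorem theorem1 (v : ℝ≥0) (hv : 0 < v) :
    ∃ c : ℝ, 0 < c ∧ ∃ c' : ℝ, 0 < c' ∧ ∃ C : ℝ, 0 < C ∧
      ∀ (m n : ℕ) (Ω : Type*) [MeasurableSpace Ω] (P : Measure Ω) [IsProbabilityMeasure P]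
        (a : Fin m → Ω → Fin n → Octonion), Octonion.IsGaussianFamily P v a →
        -- for each fixed `y` and `q`, for all `m` and `n`
        (∀ (y : Fin n → Octonion) (q : Octonion),
          1 - Real.exp (-(c ^ 2 * m / 2)) ≤
            P.real {ω | c' * m *
                Octonion.frobenius
                  (Octonion.outer (Octonion.rightScale y q) - Octonion.outer y) ^ 2 ≤
              ∑ l, (‖Octonion.conjDot (a l ω) (Octonion.rightScale y q)‖ ^ 2 -
                ‖Octonion.conjDot (a l ω) y‖ ^ 2) ^ 2}) ∧
        -- simultaneously for all `y` and `q`, once `m` is at least `C n`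
        (C * n ≤ m →
          1 - Real.exp (-(c ^ 2 * m / 2)) ≤
            P.real {ω | ∀ (y : Fin n → Octonion) (q : Octonion),
              c' * m *
                Octonion.frobenius
                  (Octonion.outer (Octonion.rightScale y q) - Octonion.outer y) ^ 2 ≤
              ∑ l, (‖Octonion.conjDot (a l ω) (Octonion.rightScale y q)‖ ^ 2 -
                ‖Octonion.conjDot (a l ω) y‖ ^ 2) ^ 2}) := by
  have hκ4 := gaussMoment_four_pos
  obtain ⟨τ, hτ, κ, hκ, C, hC, H⟩ :=
    exists_uniform_small_ball_bound 16 (b := 2 * gaussMoment 4 / 3) (by positivity)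
  -- `c² / 2 = κ`; the squared form scales by `v²`; the real dimension is `8 n`.
  refine ⟨√(2 * κ), by positivity, (v : ℝ) ^ 2 * τ ^ 2, by positivity, 8 * C, by positivity, ?_⟩
  intro m n Ω _ P _ a ha
  have hexp : √(2 * κ) ^ 2 * m / 2 = κ * m := by rw [Real.sq_sqrt (by positivity)]; ring
  rw [hexp]
  have hlaw := ha.hasLaw hv
  have hv' : √(v : ℝ) ≠ 0 := by positivity
  obtain ⟨Hfix, Hunif⟩ := H (E := EuclideanSpace ℝ (Fin n × Fin 8)) m
  have hscale (ω : Ω) (l : Fin m) : Octonion.toReal (a l ω) =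
      √(v : ℝ) • (√(v : ℝ))⁻¹ • Octonion.toReal (a l ω) := (smul_inv_smul₀ hv' _).symm
  have hzero (x y : Fin n → Octonion) (ω : Ω)
      (h : ¬ 0 < Octonion.frobenius (Octonion.outer x - Octonion.outer y) ^ 2) :
      (v : ℝ) ^ 2 * τ ^ 2 * m * Octonion.frobenius (Octonion.outer x - Octonion.outer y) ^ 2 ≤
        ∑ l, (‖Octonion.conjDot (a l ω) x‖ ^ 2 - ‖Octonion.conjDot (a l ω) y‖ ^ 2) ^ 2 := by
    rw [le_antisymm (not_lt.1 h) (sq_nonneg _), mul_zero]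
    positivity
  refine ⟨fun y q => ?_, fun hm => ?_⟩
  · by_cases hpos : 0 < Octonion.frobenius
        (Octonion.outer (Octonion.rightScale y q) - Octonion.outer y) ^ 2
    · obtain ⟨w, u, hwu, hle⟩ := Octonion.exists_isNormalizedForm_of_ne_zero hpos v.2
      refine Octonion.one_sub_le_measureReal_of_compl hlaw (Hfix w u hwu) fun ω hω => ?_
      exact hle m (fun l => a l ω) _ τ hτ.le (hscale ω) (not_lt.1 hω)
    · refine Octonion.one_sub_le_measureReal_of_compl hlaw (B := ∅)
        (by simpa using (Real.exp_pos _).le) fun ω _ => hzero _ _ ω hpos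
  -- The uniform bound needs positive dimension; for `n = 0` the Frobenius norm vanishes.
  · rcases Nat.eq_zero_or_pos n with rfl | hn
    · refine Octonion.one_sub_le_measureReal_of_compl hlaw (B := ∅)
        (by simpa using (Real.exp_pos _).le) fun ω _ y q => hzero _ _ ω ?_
      simp [Octonion.frobenius]
    have hdim : Module.finrank ℝ (EuclideanSpace ℝ (Fin n × Fin 8)) = n * 8 := by simp
    refine Octonion.one_sub_le_measureReal_of_compl hlaw
      (Hunif (by omega) (by rw [hdim]; push_cast; linarith)) fun ω hω y q => ?_
    by_cases hpos : 0 < Octonion.frobenius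
        (Octonion.outer (Octonion.rightScale y q) - Octonion.outer y) ^ 2
    · obtain ⟨w, u, hwu, hle⟩ := Octonion.exists_isNormalizedForm_of_ne_zero hpos v.2
      refine hle m (fun l => a l ω) _ τ hτ.le (hscale ω) (not_lt.1 fun hlt => hω ?_)
      exact ⟨w, u, hwu, hlt⟩
    · exact hzero _ _ ω hpos
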